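/- **Model.** A network is a finite directed graph without loops and without parallel links. Time is divided into rounds. Each link $e$ has a transmission time $d_e\in\{1,2,\dots\}$, the number of rounds that it needs to transmit one message; the network is *unit-time* if $d_e=1$ for all $e$. In each round the adversary injects finitely many packets, each with a nonempty directed path to traverse that uses no link twice. A packet waits in the queue of the next link of its path until it has crossed that link, and disappears after crossing its last link. In each round every link with a nonempty queue attempts to transmit one packet of its queue: the one whose transmission it has already partly carried out, if there is one, and otherwise one over which no packet of the queue has priority under the scheduling policy (ties may be broken in any way). The adversary decides which attempts fail; a packet whose attempt fails is *stalled* in that round and makes no progress. A packet crosses $e$ once $d_e$ attempts on $e$ have succeeded. **Policies.** FIFO gives priority to the packet that has been in the queue longer; NTG (Nearest-To-Go) to the packet with fewer links still to cross; FFS (Farthest-From-Source) to the packet that has crossed more links; SPL-NFS (Slowest-Previous-Link, ties broken by Nearest-From-Source) to the packet for which the link crossed last has the larger transmission time (taken to be $0$ for a packet still at its source) and, if these are equal, to the packet that has crossed fewer links. **Adversary.** The delayed-feedback adversary of type $(r,b,\delta)$, with injection rate $r$ and integers $b,\delta\ge 1$, is restricted by a bucket $K_e$ for each link $e$, initially $0$.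 In each round: (1) $K_e\leftarrow\min(K_e+r/d_e,\,b)$; (2) if $i>0$ packets whose paths contain $e$ are injected, then $i\le K_e$ is required, and $K_e\leftarrow K_e-i$; (3) $K_e\leftarrow K_e-r/d_e$ for each antitoken of $e$ that disappears in this round. When a packet is stalled in round $t$, one antitoken is created for each link that the packet still has to cross (including the current one); these antitokens all disappear in one common round $t'$ with $t\le t'\le t+\delta$, chosen by the adversary. On a unit-time network, $d_e=1$ throughout. A policy is *stable* in a network against this adversary if in each execution the number of packets in the system is bounded over all rounds, and *unstable* otherwise. **Claim.** For each of the policies FIFO, NTG and FFS there are a unit-time network $G$, a rate $0<r<1$ and a burstiness $b\ge1$ such that, for every integer $\delta\ge 1$, the policy is unstable in $G$ against the delayed-feedback adversary of type $(r,b,\delta)$. For SPL-NFS there are a network $G$ (with link transmission times), a rate $0<r<1$ and a burstiness $b\ge1$ such that, for every integer $\delta\ge1$, SPL-NFS is unstable in $G$ against the delayed-feedback adversary of type $(r,b,\delta)$. -/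

import Mathlib

namespace AdversarialRouting

/-- A network: a finite directed graph without loops and parallel links.  `transTime e` is the
number of rounds that a link needs to transmit one message; the basic synchronous model is the
case in which it is `1` on every link (`Network.UnitTime`). -/
structure Network where
  Node : Type
  Link : Type
  node_finite : Finite Node
  link_finite : Finite Link
  src : Link → Node
  tgt : Link → Node
  no_loop : ∀ e, src e ≠ tgt e
  no_parallel : ∀ e f, src e = src f → tgt e = tgt f → e = f
  transTime : Link → ℕ
  transTime_pos : ∀ e, 0 < transTime e

/-- Every link transmits a message in one round. -/
def Network.UnitTime (G : Network) : Prop := ∀ e, G.transTime e = 1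

/-- A route: a nonempty directed path, given by its links, that uses no link twice. -/
def Network.IsRoute (G : Network) (l : List G.Link) : Prop :=
  l ≠ [] ∧ l.Nodup ∧ l.IsChain (fun e f => G.tgt e = G.src f)

/-- What a scheduling policy may know about a packet waiting in a queue: its route, the number of
links of the route that it has crossed, and the first round in which it was present in the queue
in which it is waiting. -/
structure Info (G : Network) where
  route : List G.Link
  crossed : ℕ
  arrival : ℕ

/-- The number of links that the packet still has to cross. -/
def Info.toGo {G : Network} (x : Info G) : ℕ := x.route.length - x.crossed

/-- The transmission time of the link that the packet crossed last, and `0` if the packet is still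
at its source. -/
def Info.prevTime {G : Network} (x : Info G) : ℕ :=
  if x.crossed = 0 then 0 else (x.route[x.crossed - 1]?).elim 0 G.transTime

/-- A scheduling policy is given by its strict priority relation: `S G x y` says that `x` has
priority over `y`. Packets neither of which has priority over the other are tied. -/
abbrev Policy : Type 1 := ∀ G : Network, Info G → Info G → Prop

/-- First-In-First-Out. -/
def FIFO : Policy := fun _ x y => x.arrival < y.arrival

/-- Nearest-To-Go. -/
def NTG : Policy := fun _ x y => x.toGo < y.toGo

/-- Farthest-From-Source. -/
def FFS : Policy := fun _ x y => y.crossed < x.crossed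

/-- Slowest-Previous-Link, with ties broken by Nearest-From-Source. -/
def SPLNFS : Policy := fun _ x y =>
  y.prevTime < x.prevTime ∨ (x.prevTime = y.prevTime ∧ x.crossed < y.crossed)

/-- The decisions that determine an evolution of the system with set of packets `P`: the round in
which each packet is injected and its route, the packet (if any) whose transmission over a link is
attempted in a round, whether this attempt fails, and the round in which the antitokens created
by the failed attempt disappear. Rounds are numbered `0, 1, 2, …`. -/
structure Run (G : Network) (P : Type) where
  birth : P → ℕ
  route : P → List G.Link
  attempt : G.Link → ℕ → Option P
  fails : G.Link → ℕ → Prop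
  feedback : G.Link → ℕ → ℕ

namespace Run

variable {G : Network} {P : Type} (X : Run G P)

open Classical in
/-- The state of a packet at the start of round `t`: the number of links crossed, and the
number of rounds of work already spent on its transmission over the next link. -/
noncomputable def state (p : P) : ℕ → ℕ × ℕ
  | 0 => (0, 0)
  | t + 1 =>
    let s := state p t
    match (X.route p)[s.1]? with
    | none => s
    | some q =>
      if X.attempt q t = some p ∧ ¬ X.fails q t then
        if s.2 + 1 < G.transTime q then (s.1, s.2 + 1) else (s.1 + 1, 0)
      else s

/-- The number of links that `p` has crossed before round `t`. -/
noncomputable def crossed (p : P) (t : ℕ) : ℕ := (X.state p t).1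

/-- The number of rounds of work spent before round `t` on the current link of `p`. -/
noncomputable def work (p : P) (t : ℕ) : ℕ := (X.state p t).2

/-- The links that `p` still has to cross at the start of round `t`. -/
noncomputable def remaining (p : P) (t : ℕ) : List G.Link := (X.route p).drop (X.crossed p t)

/-- The packets waiting to cross the link `q` in round `t`, after the injections of round `t`. -/
def queue (q : G.Link) (t : ℕ) : Set P :=
  {p | X.birth p ≤ t ∧ (X.route p)[X.crossed p t]? = some q}

/-- What the policy knows about `p` in round `t`. -/
noncomputable def info (p : P) (t : ℕ) : Info G where
  route := X.route p
  crossed := X.crossed p t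
  arrival := sInf {u | X.birth p ≤ u ∧ X.crossed p u = X.crossed p t}

/-- The number of packets in the system in round `t`. -/
noncomputable def queued (t : ℕ) : ℕ :=
  {p | X.birth p ≤ t ∧ X.remaining p t ≠ []}.ncard

/-- `X` is an execution of the policy `S`. A link with a nonempty queue always attempts to transmit
a packet of the queue: the one whose transmission it has already partly carried out, if there is
one, and otherwise one over which no packet of the queue has priority. -/
structure IsExecution (S : Policy) : Prop where
  finite_birth : ∀ t, {p | X.birth p = t}.Finite
  isRoute : ∀ p, G.IsRoute (X.route p)
  attempt_mem : ∀ q t p, X.attempt q t = some p → p ∈ X.queue q t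
  attempt_of_nonempty : ∀ q t, (X.queue q t).Nonempty → X.attempt q t ≠ none
  fails_attempt : ∀ q t, X.fails q t → X.attempt q t ≠ none
  nonpreemptive : ∀ q t p p', X.attempt q t = some p → p' ∈ X.queue q t → 0 < X.work p' t → p = p'
  priority : ∀ q t p p', X.attempt q t = some p → X.work p t = 0 → p' ∈ X.queue q t →
    ¬ S G (X.info p' t) (X.info p t)

/-- The number of packets injected in round `t` that are to traverse `e`. -/
noncomputable def injected (e : G.Link) (t : ℕ) : ℕ := {p | X.birth p = t ∧ e ∈ X.route p}.ncard

/-- The number of antitokens of the bucket of `e` that disappear in round `t`. A packet whose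
transmission over `q` fails in round `u` creates one antitoken for each link that it still has to
traverse, `q` included, and all of them disappear in the same round `feedback q u`. -/
noncomputable def antitokens (e : G.Link) (t : ℕ) : ℕ :=
  {x : G.Link × ℕ | X.fails x.1 x.2 ∧ X.feedback x.1 x.2 = t ∧
    ∃ p, X.attempt x.1 x.2 = some p ∧ e ∈ X.remaining p x.2}.ncard

/-- The content of the bucket of `e` at the start of round `t`. In a round, first the injection
rate (`r` messages per transmission time of the link) is added, subject to the capacity
`b`; then a token is removed for each injected packet that is to traverse `e`; then the increment
of one round is taken away for each antitoken that disappears. -/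
noncomputable def bucket (r : ℝ) (b : ℕ) (e : G.Link) : ℕ → ℝ
  | 0 => 0
  | t + 1 => min (bucket r b e t + r / G.transTime e) b - X.injected e t
      - r / G.transTime e * X.antitokens e t

/-- The delayed-feedback leaky-bucket adversary of type `(r, b, δ)` can produce `X`. -/
structure IsAdmissible (r : ℝ) (b δ : ℕ) : Prop where
  feedback_mem : ∀ q t, X.fails q t → t ≤ X.feedback q t ∧ X.feedback q t ≤ t + δ
  injected_le : ∀ e t, 0 < X.injected e t →
    (X.injected e t : ℝ) ≤ min (X.bucket r b e t + r / G.transTime e) b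

end Run

/-- The policy `S` is stable in the network `G` against the delayed-feedback adversary of
type `(r, b, δ)`: in each execution the number of packets in the system is bounded. -/
def Stable (S : Policy) (G : Network) (r : ℝ) (b δ : ℕ) : Prop :=
  ∀ (P : Type) (X : Run G P), X.IsExecution S → X.IsAdmissible r b δ →
    ∃ B : ℕ, ∀ t, X.queued t ≤ B

/-- The policy `S` is unstable: it is not stable. -/
def Unstable (S : Policy) (G : Network) (r : ℝ) (b δ : ℕ) : Prop := ¬ Stable S G r b δ

end AdversarialRouting

/-! No transmission ever fails in the execution built here, so antitokens and `δ` play no role: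
ordinary injections at rate 9/10 already cause instability. One execution serves all four policies.
Every route has four links, all links are unit-time, service is first-in-first-out, and packets that
meet have crossed equally many links unless the one served later is still at its source. Under these
conditions no policy objects to the order of service (`Timetable.IsValid.isExecution`).

The network has two halves, and load is pumped from one entrance `e` to the other. Put s = n + 40.
Phase n starts with 1000s packets still to cross the entrance of its half. While they cross, 900s
packets X are injected behind them. During the next 900s rounds the X cross the entrance, 810s
packets Y queue behind them, and packets Z, injected every second round, slow the X down at `f`:
300s of the X are still short of the other entrance when this stage ends. During the last 810s
rounds the Y, these X and fresh packets W all converge on the other entrance, 1810s + 1007 in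
number. It serves 810s + 7 of them before the next phase, so 1000(s + 1) remain (`Pump.le_queued`).

The work lies in checking that the explicit schedule is consistent (`Pump.order`, `Pump.busy`) and
within the injection budget (`Pump.isAdmissible`). -/

namespace AdversarialRouting

/-! ### Failure-free timetables and the runs that follow them -/

/-- A timetable prescribes the birth and the route of each packet and the round `cross p k` in
which the packet `p` crosses the link number `k` of its route. -/
structure Timetable (G : Network) (P : Type) where
  birth : P → ℕ
  route : P → List G.Link
  cross : P → ℕ → ℕ

namespace Timetable

variable {G : Network} {P : Type} (Y : Timetable G P)

/-- The first round in which `p` waits for the link number `k` of its route. -/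
def arr (p : P) : ℕ → ℕ
  | 0 => Y.birth p
  | k + 1 => Y.cross p k + 1

/-- The timetable describes a work-conserving first-in-first-out evolution in which all routes have
length `L`, and in which packets that meet in a queue have crossed equally many links, unless the
one that is served later is still at its source. -/
structure IsValid (L : ℕ) : Prop where
  finite_birth : ∀ t, {p | Y.birth p = t}.Finite
  isRoute : ∀ p, G.IsRoute (Y.route p)
  length_route : ∀ p, (Y.route p).length = L
  arr_le : ∀ p k, k < L → Y.arr p k ≤ Y.cross p k
  order : ∀ p k p' k' q, (Y.route p)[k]? = some q → (Y.route p')[k']? = some q →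
    Y.arr p' k' ≤ Y.cross p k → Y.cross p k ≤ Y.cross p' k' →
    (p = p' ∧ k = k') ∨
      (Y.cross p k < Y.cross p' k' ∧ Y.arr p k ≤ Y.arr p' k' ∧ (k' = k ∨ k' = 0))
  busy : ∀ p k q t, (Y.route p)[k]? = some q → Y.arr p k ≤ t → t ≤ Y.cross p k →
    ∃ p' k', (Y.route p')[k']? = some q ∧ Y.cross p' k' = t

open Classical in
/-- The run without failures that follows the timetable. -/
noncomputable def toRun : Run G P where
  birth := Y.birth
  route := Y.route
  attempt q t :=
    if h : ∃ p k, (Y.route p)[k]? = some q ∧ Y.cross p k = t then some h.choose else none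
  fails _ _ := False
  feedback _ _ := 0

namespace IsValid

variable {Y} {L : ℕ}

theorem lt_of_getElem? (hY : Y.IsValid L) {p : P} {k : ℕ} {q : G.Link} (h : (Y.route p)[k]? = some q) : k < L := by
  have := (List.getElem?_eq_some_iff.1 h).1
  rwa [hY.length_route] at this

theorem eq_of_cross_eq (hY : Y.IsValid L) {p p' : P} {k k' : ℕ} {q : G.Link} (h : (Y.route p)[k]? = some q)
    (h' : (Y.route p')[k']? = some q) (hc : Y.cross p k = Y.cross p' k') : p = p' ∧ k = k' := by
  have h1 := hY.arr_le p' k' (hY.lt_of_getElem? h')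
  rcases hY.order p k p' k' q h h' (by omega) hc.le with h2 | h2
  · exact h2
  · omega

theorem attempt_eq_some_iff (hY : Y.IsValid L) (q : G.Link) (t : ℕ) (p : P) :
    Y.toRun.attempt q t = some p ↔ ∃ k, (Y.route p)[k]? = some q ∧ Y.cross p k = t := by
  unfold toRun
  dsimp only
  split_ifs with h
  · obtain ⟨k₀, h₀⟩ := h.choose_spec
    constructor
    · intro hp
      have hp := Option.some.inj hp
      rw [hp] at h₀
      exact ⟨k₀, h₀⟩
    · rintro ⟨k, hk, hc⟩
      rw [(hY.eq_of_cross_eq h₀.1 hk (h₀.2.trans hc.symm)).1]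
  · simp only [false_iff]
    exact fun h' => h ⟨p, h'⟩

theorem cross_lt_cross (hY : Y.IsValid L) (p : P) {j k : ℕ} (hjk : j < k) (hk : k < L) :
    Y.cross p j < Y.cross p k := by
  induction k, hjk using Nat.le_induction with
  | base => exact hY.arr_le p (j + 1) hk
  | succ k hjk ih => exact (ih (by omega)).trans (hY.arr_le p (k + 1) hk)

/-- With unit times and no failures each attempt is a crossing, so partial work never occurs and the
recursive state can be read off the crossing rounds. -/
theorem state_spec (hG : G.UnitTime) (hY : Y.IsValid L) (p : P) (t : ℕ) :
    ∃ k ≤ L, Y.toRun.state p t = (k, 0) ∧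
      (∀ j < k, Y.cross p j < t) ∧ (k < L → t ≤ Y.cross p k) := by
  induction t with
  | zero => exact ⟨0, by omega, rfl, by omega, by omega⟩
  | succ t ih =>
    obtain ⟨k, hkL, hs, h1, h2⟩ := ih
    rw [Run.state, hs]
    have hr : Y.toRun.route p = Y.route p := rfl
    rcases hkL.lt_or_eq with hk | rfl
    · obtain ⟨q, hq⟩ : ∃ q, (Y.route p)[k]? = some q :=
        ⟨_, List.getElem?_eq_getElem (by rwa [hY.length_route])⟩
      have hf : ¬ Y.toRun.fails q t := fun h => h
      simp only [hr, hq]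
      by_cases hc : Y.cross p k = t
      · have ha := (hY.attempt_eq_some_iff q t p).2 ⟨k, hq, hc⟩
        rw [if_pos ⟨ha, hf⟩, if_neg (by rw [hG]; omega)]
        refine ⟨k + 1, hk, rfl, fun j hj => ?_, fun h => ?_⟩
        · rcases (Nat.lt_succ_iff.1 hj).lt_or_eq with h | rfl
          · exact (h1 j h).trans (by omega)
          · omega
        · have : Y.cross p k < Y.cross p (k + 1) := hY.cross_lt_cross p (Nat.lt_succ_self k) h
          omega
      · have ha : ¬ Y.toRun.attempt q t = some p := by
          rintro ha
          obtain ⟨k', hk', hc'⟩ := (hY.attempt_eq_some_iff q t p).1 ha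
          have : k' < L := hY.lt_of_getElem? hk'
          rcases lt_trichotomy k' k with h | rfl | h
          · have := h1 k' h
            omega
          · exact hc hc'
          · have := hY.cross_lt_cross p h this
            have := h2 hk
            omega
        rw [if_neg (fun h => ha h.1)]
        refine ⟨k, hkL, rfl, fun j hj => (h1 j hj).trans (by omega), fun _ => ?_⟩
        have := h2 hk
        omega
    · have hq : (Y.route p)[k]? = none := by
        rw [List.getElem?_eq_none_iff, hY.length_route]
      simp only [hr, hq]
      exact ⟨k, le_rfl, rfl, fun j hj => (h1 j hj).trans (by omega), by omega⟩

theorem crossed_eq (hG : G.UnitTime) (hY : Y.IsValid L) {p : P} {k t : ℕ} (hk : k < L)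
    (h1 : Y.arr p k ≤ t) (h2 : t ≤ Y.cross p k) : Y.toRun.crossed p t = k := by
  obtain ⟨l, hl, hs, h3, h4⟩ := hY.state_spec hG p t
  rw [Run.crossed, hs]
  rcases lt_trichotomy l k with h | h | h
  · obtain ⟨k, rfl⟩ : ∃ m, k = m + 1 := ⟨k - 1, by omega⟩
    have h5 : Y.cross p k < t := h1
    have h6 : Y.cross p l ≤ Y.cross p k := by
      rcases (Nat.lt_succ_iff.1 h).lt_or_eq with h | rfl
      · exact (hY.cross_lt_cross p h (by omega)).le
      · exact le_rfl
    have := h4 (by omega)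
    omega
  · exact h
  · have := h3 k h
    omega

theorem arr_le_and_le_cross (hG : G.UnitTime) (hY : Y.IsValid L) {p : P} {t : ℕ}
    (hb : Y.birth p ≤ t) (hk : Y.toRun.crossed p t < L) :
    Y.arr p (Y.toRun.crossed p t) ≤ t ∧ t ≤ Y.cross p (Y.toRun.crossed p t) := by
  obtain ⟨l, hl, hs, h3, h4⟩ := hY.state_spec hG p t
  rw [Run.crossed, hs] at hk ⊢
  refine ⟨?_, h4 hk⟩
  dsimp only at hk ⊢
  cases l with
  | zero => exact hb
  | succ l => exact h3 l (Nat.lt_succ_self l)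

theorem birth_le_arr (hY : Y.IsValid L) (p : P) {k : ℕ} (hk : k < L) :
    Y.birth p ≤ Y.arr p k := by
  induction k with
  | zero => exact le_rfl
  | succ k ih => exact ((ih (by omega)).trans (hY.arr_le p k (by omega))).trans (Nat.le_succ _)

theorem mem_queue_iff (hG : G.UnitTime) (hY : Y.IsValid L) (p : P) (q : G.Link) (t : ℕ) :
    p ∈ Y.toRun.queue q t ↔
      ∃ k, (Y.route p)[k]? = some q ∧ Y.arr p k ≤ t ∧ t ≤ Y.cross p k := by
  constructor
  · rintro ⟨hb, hq⟩
    exact ⟨_, hq, hY.arr_le_and_le_cross hG hb (hY.lt_of_getElem? hq)⟩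
  · rintro ⟨k, hq, h1, h2⟩
    have hk := hY.lt_of_getElem? hq
    refine ⟨(hY.birth_le_arr p hk).trans h1, ?_⟩
    rw [hY.crossed_eq hG hk h1 h2]
    exact hq

theorem info_eq (hG : G.UnitTime) (hY : Y.IsValid L) {p : P} {k t : ℕ} (hk : k < L)
    (h1 : Y.arr p k ≤ t) (h2 : t ≤ Y.cross p k) :
    Y.toRun.info p t = ⟨Y.route p, k, Y.arr p k⟩ := by
  have hc := hY.crossed_eq hG hk h1 h2
  have ha : sInf {u | Y.toRun.birth p ≤ u ∧ Y.toRun.crossed p u = k} = Y.arr p k := by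
    apply le_antisymm
    · exact Nat.sInf_le
        ⟨hY.birth_le_arr p hk, hY.crossed_eq hG hk le_rfl (hY.arr_le p k hk)⟩
    · refine le_csInf ⟨t, (hY.birth_le_arr p hk).trans h1, hc⟩ ?_
      rintro u ⟨hu, rfl⟩
      exact (hY.arr_le_and_le_cross hG hu hk).1
  rw [Run.info, hc, ha]
  rfl

/-- On a unit-time network the previous link only tells packets at their source from all others. -/
theorem prevTime_eq (hG : G.UnitTime) (hY : Y.IsValid L) (p : P) {k : ℕ} (hk : k < L) (a : ℕ) :
    (⟨Y.route p, k, a⟩ : Info G).prevTime = if k = 0 then 0 else 1 := by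
  unfold Info.prevTime
  have h : k - 1 < (Y.route p).length := by
    rw [hY.length_route]
    omega
  simp only [List.getElem?_eq_getElem h, Option.elim_some, hG _]

/-- The run is an execution of each of the policies FIFO, NTG, FFS and SPL-NFS. -/
theorem isExecution (hG : G.UnitTime) (hY : Y.IsValid L) {S : Policy}
    (hS : S ∈ ({FIFO, NTG, FFS, SPLNFS} : Set Policy)) : Y.toRun.IsExecution S where
  finite_birth := hY.finite_birth
  isRoute := hY.isRoute
  attempt_mem q t p hp := by
    obtain ⟨k, hq, rfl⟩ := (hY.attempt_eq_some_iff q t p).1 hp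
    exact (hY.mem_queue_iff hG p q _).2 ⟨k, hq, hY.arr_le p k (hY.lt_of_getElem? hq), le_rfl⟩
  attempt_of_nonempty q t := by
    rintro ⟨p, hp⟩ hn
    obtain ⟨k, hq, h1, h2⟩ := (hY.mem_queue_iff hG p q t).1 hp
    obtain ⟨p', k', hq', hc⟩ := hY.busy p k q t hq h1 h2
    have := (hY.attempt_eq_some_iff q t p').2 ⟨k', hq', hc⟩
    rw [hn] at this
    cases this
  fails_attempt q t h := h.elim
  nonpreemptive q t p p' _ _ hw := by
    obtain ⟨k, -, hs, -⟩ := hY.state_spec hG p' t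
    rw [Run.work, hs] at hw
    exact absurd hw (lt_irrefl 0)
  priority q t p p' hp _ hp' := by
    obtain ⟨k, hq, rfl⟩ := (hY.attempt_eq_some_iff q t p).1 hp
    obtain ⟨k', hq', h1, h2⟩ := (hY.mem_queue_iff hG p' q _).1 hp'
    have hk := hY.lt_of_getElem? hq
    have hk' := hY.lt_of_getElem? hq'
    rw [hY.info_eq hG hk' h1 h2, hY.info_eq hG hk (hY.arr_le p k hk) le_rfl]
    have ho : Y.arr p k ≤ Y.arr p' k' ∧ (k' = k ∨ k' = 0) := by
      rcases hY.order p k p' k' q hq hq' h1 h2 with ⟨rfl, rfl⟩ | h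
      · exact ⟨le_rfl, Or.inl rfl⟩
      · exact h.2
    -- Equal route lengths make NTG and FFS the same order. A waiting packet at its source has
    -- crossed the fewest links and has previous time 0, so neither of these nor SPL-NFS prefers it.
    rcases hS with rfl | rfl | rfl | rfl
    · simp only [FIFO]
      omega
    · simp only [NTG, Info.toGo, hY.length_route]
      omega
    · simp only [FFS]
      omega
    · simp only [SPLNFS, hY.prevTime_eq hG p hk, hY.prevTime_eq hG p' hk']
      rcases ho.2 with rfl | rfl
      · omega
      · by_cases h : k = 0 <;> simp [h]

/-- The number of packets in the system is at least the number of packets born so far that cross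
a given link of their routes in one of the next `N` rounds. -/
theorem le_queued (hG : G.UnitTime) (hY : Y.IsValid L) {t N : ℕ} {k : ℕ} {q : G.Link}
    (h : ∀ x < N, ∃ p, Y.birth p ≤ t ∧ (Y.route p)[k]? = some q ∧ Y.cross p k = t + x) :
    N ≤ Y.toRun.queued t := by
  rcases N.eq_zero_or_pos with rfl | hN
  · exact Nat.zero_le _
  have : Nonempty P := ⟨(h 0 hN).choose⟩
  choose! f hf using h
  have hfin : {p | Y.toRun.birth p ≤ t ∧ Y.toRun.remaining p t ≠ []}.Finite := by
    refine Set.Finite.subset ((Set.finite_le_nat t).biUnion fun u _ => hY.finite_birth u)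
      fun p hp => ?_
    simp only [Set.mem_iUnion]
    exact ⟨Y.birth p, hp.1, rfl⟩
  have hsub : f '' (Set.Iio N) ⊆ {p | Y.toRun.birth p ≤ t ∧ Y.toRun.remaining p t ≠ []} := by
    rintro _ ⟨x, hx, rfl⟩
    obtain ⟨hb, hq, hc⟩ := hf x hx
    refine ⟨hb, fun hr => ?_⟩
    have hk := hY.lt_of_getElem? hq
    obtain ⟨l, hl, hs, h3, h4⟩ := hY.state_spec hG (f x) t
    rw [Run.remaining, List.drop_eq_nil_iff, Run.crossed, hs] at hr
    have hlen : (Y.toRun.route (f x)).length = L := hY.length_route _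
    have := h3 k (by dsimp only at hr; omega)
    omega
  have hinj : Set.InjOn f (Set.Iio N) := by
    intro x hx y hy hxy
    have h1 := (hf x hx).2.2
    have h2 := (hf y hy).2.2
    rw [hxy] at h1
    omega
  calc N = (Set.Iio N).ncard := by rw [Set.ncard_eq_toFinset_card']; simp
    _ = (f '' (Set.Iio N)).ncard := hinj.ncard_image.symm
    _ ≤ _ := Set.ncard_le_ncard hsub hfin

theorem antitokens_eq_zero (e : G.Link) (t : ℕ) : Y.toRun.antitokens e t = 0 := by
  have : {x : G.Link × ℕ | Y.toRun.fails x.1 x.2 ∧ Y.toRun.feedback x.1 x.2 = t ∧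
      ∃ p, Y.toRun.attempt x.1 x.2 = some p ∧ e ∈ Y.toRun.remaining p x.2} = ∅ :=
    Set.eq_empty_of_forall_notMem fun x hx => hx.1
  rw [Run.antitokens, this, Set.ncard_empty]

end IsValid

/-! ### The injection budget -/

/-- Injections of one initial burst, followed by at most one packet per link and round in nine out
of ten rounds, are admissible. -/
theorem isAdmissible (hG : G.UnitTime) {N : ℕ} (hN : 2 ≤ N) (δ : ℕ)
    (h0 : ∀ e, ∀ t < 20 * N, Y.toRun.injected e t = 0)
    (h1 : ∀ e, Y.toRun.injected e (20 * N) ≤ N + 1)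
    (h2 : ∀ e, ∀ t > 20 * N, Y.toRun.injected e t ≤ 1)
    (h3 : ∀ e, ∀ t > 20 * N, t % 10 = 9 → Y.toRun.injected e t = 0) :
    Y.toRun.IsAdmissible (9 / 10) (N + 10) δ := by
  have ht : ∀ e, (G.transTime e : ℝ) = 1 := fun e => by rw [hG e, Nat.cast_one]
  have hstep : ∀ e t, Y.toRun.bucket (9 / 10) (N + 10) e (t + 1) =
      min (Y.toRun.bucket (9 / 10) (N + 10) e t + 9 / 10) (N + 10) - Y.toRun.injected e t := by
    intro e t
    rw [Run.bucket, ht, IsValid.antitokens_eq_zero, div_one, Nat.cast_zero, mul_zero, sub_zero,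
      Nat.cast_add, Nat.cast_ofNat]
  have hN' : (2 : ℝ) ≤ N := by exact_mod_cast hN
  have hA : ∀ e t, t ≤ 20 * N →
      min (9 / 10 * t : ℝ) (N + 10) ≤ Y.toRun.bucket (9 / 10) (N + 10) e t := by
    intro e t
    induction t with
    | zero => intro _; simp [Run.bucket]
    | succ t ih =>
      intro h
      rw [hstep, h0 e t (by omega), Nat.cast_zero, sub_zero]
      refine le_min ?_ (min_le_right _ _)
      have := ih (by omega)
      push_cast
      rcases min_le_iff.1 this with h | h
      · exact (min_le_left _ _).trans (by linarith)
      · exact (min_le_right _ _).trans (by linarith)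
  -- The 20N silent rounds supply 18N tokens, enough to fill the bucket.
  have hB : ∀ e, (N : ℝ) + 10 ≤ Y.toRun.bucket (9 / 10) (N + 10) e (20 * N) := by
    intro e
    refine le_trans (le_min ?_ le_rfl) (hA e _ le_rfl)
    push_cast
    linarith
  -- Period-ten invariant: a round with an injection costs at most 1/10 net, and the silent round of
  -- residue 9 regains 9/10.
  have hC : ∀ e t, 20 * N < t →
      (10 - (t % 10 : ℕ) : ℝ) / 10 ≤ Y.toRun.bucket (9 / 10) (N + 10) e t := by
    intro e t h
    induction t, h using Nat.le_induction with
    | base =>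
      have hinj : (Y.toRun.injected e (20 * N) : ℝ) ≤ N + 1 := by exact_mod_cast h1 e
      have hm : (N : ℝ) + 10 ≤ min (Y.toRun.bucket (9 / 10) (N + 10) e (20 * N) + 9 / 10)
          (N + 10) := le_min (by linarith [hB e]) le_rfl
      rw [Nat.succ_eq_add_one, hstep]
      have : (0 : ℝ) ≤ ((20 * N + 1) % 10 : ℕ) := Nat.cast_nonneg _
      linarith
    | succ t ht ih =>
      rw [hstep]
      by_cases h9 : t % 10 = 9
      · rw [h9] at ih
        rw [h3 e t ht h9]
        have : (t + 1) % 10 = 0 := by omega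
        rw [this]
        have : (1 : ℝ) ≤ min (Y.toRun.bucket (9 / 10) (N + 10) e t + 9 / 10) (N + 10) := by
          refine le_min ?_ (by linarith)
          push_cast at ih
          linarith
        push_cast
        linarith
      · have hinj : (Y.toRun.injected e t : ℝ) ≤ 1 := by exact_mod_cast h2 e t ht
        have hm : (t + 1) % 10 = t % 10 + 1 := by omega
        rw [hm]
        have h4 : (0 : ℝ) ≤ (t % 10 : ℕ) := Nat.cast_nonneg _
        have : (10 - (t % 10 : ℕ) : ℝ) / 10 + 9 / 10 ≤
            min (Y.toRun.bucket (9 / 10) (N + 10) e t + 9 / 10) (N + 10) :=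
          le_min (by linarith) (by linarith)
        push_cast at *
        linarith
  refine ⟨fun q t h => h.elim, fun e t h => ?_⟩
  rw [ht, div_one]
  push_cast
  rcases lt_trichotomy t (20 * N) with ht | rfl | ht
  · have := h0 e t ht
    omega
  · have hinj : (Y.toRun.injected e (20 * N) : ℝ) ≤ N + 1 := by exact_mod_cast h1 e
    exact le_min (by linarith [hB e]) (by linarith)
  · have hinj : (Y.toRun.injected e t : ℝ) ≤ 1 := by exact_mod_cast h2 e t ht
    have h9 : t % 10 ≤ 8 := by
      by_contra h9
      have := h3 e t ht (by omega)
      omega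
    have h9' : ((t % 10 : ℕ) : ℝ) ≤ 8 := by exact_mod_cast h9
    exact le_min (by linarith [hC e t ht]) (by linarith)

end Timetable

/-! ### First-in-first-out service at a saturated server -/

/-- Jobs that arrive at a server at least as fast as it serves them up to round `D`, and not later,
can be served one per round in the order of their arrival. -/
theorem exists_service_order {N D : ℕ} (a : ℕ → ℕ) (h1 : ∀ q < N, a q ≤ D)
    (h2 : ∀ q < D, a q ≤ q) :
    ∃ pos inv : ℕ → ℕ, ∀ q < N, pos q < N ∧ inv q < N ∧ pos (inv q) = q ∧ inv (pos q) = q ∧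
      a q ≤ pos q ∧ ∀ q' < N, pos q < pos q' → a q ≤ a q' := by
  let b : Fin N → ℕ := fun q => a q
  let τ := Tuple.sort b
  have hτ : ∀ p q : Fin N, τ.symm p ≤ τ.symm q → a p ≤ a q := fun p q h => by
    have := Tuple.monotone_sort b h
    simpa [τ, b] using this
  have hle : ∀ p : Fin N, a p ≤ τ.symm p := by
    intro p
    by_contra! hlt
    have hp := h1 p p.2
    -- Pigeonhole: if job p were served before it arrives, the jobs numbered up to its position
    -- would all have arrived earlier than p, hence precede it in the sorted order; they are one too
    -- many for the places before p.
    have hsub : (Finset.Iic (τ.symm p)).map τ.symm.toEmbedding ⊆ Finset.Iio (τ.symm p) := by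
      intro x hx
      obtain ⟨q, hq, rfl⟩ := Finset.mem_map.1 hx
      have hq : q ≤ τ.symm p := Finset.mem_Iic.1 hq
      have hq' : (q : ℕ) ≤ τ.symm p := hq
      have := h2 q (by omega)
      refine Finset.mem_Iio.2 (lt_of_not_ge fun h => ?_)
      have := hτ p q h
      omega
    have := Finset.card_le_card hsub
    rw [Finset.card_map, Fin.card_Iic, Fin.card_Iio] at this
    omega
  refine ⟨fun q => if h : q < N then τ.symm ⟨q, h⟩ else 0,
    fun q => if h : q < N then τ ⟨q, h⟩ else 0, fun q hq => ?_⟩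
  simp only [hq, dite_true, Fin.is_lt, Fin.eta, Equiv.symm_apply_apply, Equiv.apply_symm_apply,
    true_and]
  refine ⟨hle ⟨q, hq⟩, fun q' hq' h => hτ ⟨q, hq⟩ ⟨q', hq'⟩ ?_⟩
  simp only [hq', dite_true] at h
  exact le_of_lt h

namespace Pump

/-! ### The network and its schedule -/

/-- The kinds of nodes of the network. -/
inductive NodeKind
  | A | B | M | N | H | O | W | U | V
  deriving DecidableEq

/-- The kinds of links of the network. -/
inductive LinkKind
  | e | f | g | a | c | h | y | w | u | x
  deriving DecidableEq

open NodeKind LinkKind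

instance : Fintype NodeKind where
  elems := {A, B, M, N, H, O, W, U, V}
  complete k := by cases k <;> decide

instance : Fintype LinkKind where
  elems := {e, f, g, a, c, h, y, w, u, x}
  complete k := by cases k <;> decide

/-- The tail of a link. -/
def src : Bool × LinkKind → Bool × NodeKind
  | (i, .e) => (i, A)
  | (i, .f) => (i, B)
  | (i, .g) => (i, M)
  | (i, .a) => (i, B)
  | (i, .c) => (i, N)
  | (i, .h) => (i, H)
  | (i, .y) => (!i, A)
  | (i, .w) => (i, W)
  | (i, .u) => (i, U)
  | (i, .x) => (i, V)

/-- The head of a link. -/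
def tgt : Bool × LinkKind → Bool × NodeKind
  | (i, .e) => (i, B)
  | (i, .f) => (i, M)
  | (i, .g) => (!i, A)
  | (i, .a) => (i, N)
  | (i, .c) => (!i, A)
  | (i, .h) => (i, B)
  | (i, .y) => (i, O)
  | (i, .w) => (i, U)
  | (i, .u) => (i, V)
  | (i, .x) => (!i, A)

/-- The network: two halves, each of which has an entrance `e` from which two disjoint paths lead
to the entrance of the other half. -/
def net : Network where
  Node := Bool × NodeKind
  Link := Bool × LinkKind
  node_finite := inferInstance
  link_finite := inferInstance
  src := src
  tgt := tgt
  no_loop := by decide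
  no_parallel := by
    rintro ⟨_ | _, k⟩ ⟨_ | _, l⟩ <;> cases k <;> cases l <;> simp [src, tgt]
  transTime _ := 1
  transTime_pos _ := one_pos

theorem unitTime_net : net.UnitTime := fun _ => rfl

/-- The round in which the phase number `n` begins. -/
def T (n : ℕ) : ℕ := 800000 + ∑ i ∈ Finset.range n, (2710 * (i + 40) + 10)

theorem T_zero : T 0 = 800000 := by rw [T, Finset.sum_range_zero, add_zero]

theorem T_succ (n : ℕ) : T (n + 1) = T n + 2710 * (n + 40) + 10 := by
  simp only [T, Finset.sum_range_succ, add_assoc]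

attribute [irreducible] T

theorem T_mod (n : ℕ) : T n % 10 = 0 := by
  induction n with
  | zero => rw [T_zero]
  | succ n ih => rw [T_succ]; omega

theorem T_le {n m : ℕ} (h : n < m) : T n + 2710 * (n + 40) + 10 ≤ T m := by
  induction m, h using Nat.le_induction with
  | base => rw [Nat.succ_eq_add_one, T_succ]
  | succ m _ ih => rw [T_succ]; omega

theorem T_zero_le (n : ℕ) : T 0 ≤ T n := by
  rcases n.eq_zero_or_pos with rfl | h
  · exact le_rfl
  · have := T_le h
    linarith

theorem T_cases (n m : ℕ) : (n = m ∧ T n = T m) ∨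
    (m = n + 1 ∧ T m = T n + 2710 * (n + 40) + 10) ∨
    (n = m + 1 ∧ T n = T m + 2710 * (m + 40) + 10) ∨
    (n + 2 ≤ m ∧ T n + 5420 * (n + 40) + 2730 ≤ T m) ∨
    (m + 2 ≤ n ∧ T m + 5420 * (m + 40) + 2730 ≤ T n) := by
  have key : ∀ n m, n + 2 ≤ m → T n + 5420 * (n + 40) + 2730 ≤ T m := by
    intro n m h
    have h1 := T_le (show n + 1 < m from h)
    have h2 := T_succ n
    linarith
  rcases lt_trichotomy n m with h | h | h
  · rcases (Nat.succ_le_of_lt h).lt_or_eq with h | rfl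
    · exact Or.inr (Or.inr (Or.inr (Or.inl ⟨h, key n m h⟩)))
    · exact Or.inr (Or.inl ⟨rfl, T_succ _⟩)
  · exact Or.inl ⟨h, congrArg T h⟩
  · rcases (Nat.succ_le_of_lt h).lt_or_eq with h | rfl
    · exact Or.inr (Or.inr (Or.inr (Or.inr ⟨h, key m n h⟩)))
    · exact Or.inr (Or.inr (Or.inl ⟨rfl, T_succ _⟩))

/-- The half of the network at whose entrance the packets of the phase number `n` begin. -/
def half (n : ℕ) : Bool := decide (n % 2 = 1)

theorem half_eq_half {n m : ℕ} : half n = half m ↔ n % 2 = m % 2 := by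
  simp only [half, decide_eq_decide]
  omega

theorem not_half_eq_half {n m : ℕ} : (!half n) = half m ↔ n % 2 ≠ m % 2 := by
  rw [eq_comm, Bool.eq_not, Ne, half_eq_half, eq_comm]

theorem half_eq_not_half {n m : ℕ} : half n = !half m ↔ n % 2 ≠ m % 2 := by
  rw [Bool.eq_not, Ne, half_eq_half]

/-- The round, counted from the arrival of the first of them, in which the packet number `q` of
those that accumulate during the phase number `n` arrives at its last link. -/
def lateArr (n q : ℕ) : ℕ :=
  -- The three streams are Y at rate 1, the delayed X at rate 2/3 and W at rate 9/10.
  if q < 810 * (n + 40) then q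
  else if q < 1110 * (n + 40) then
    (q - 810 * (n + 40)) + (q - 810 * (n + 40)) / 2
  else (q - 1110 * (n + 40)) + (q - 1110 * (n + 40)) / 9

/-- The critical stream is W, which needs about 10/9 · (700s + 1007) rounds, s = n + 40. This is at
most 810s once s ≥ 35; the shift by 40 provides that. -/
theorem lateArr_le {n q : ℕ} (hq : q < 1810 * (n + 40) + 1007) :
    lateArr n q ≤ 810 * (n + 40) := by
  unfold lateArr
  split_ifs <;> omega

theorem exists_late_order (n : ℕ) : ∃ pos inv : ℕ → ℕ, ∀ q < 1810 * (n + 40) + 1007,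
    pos q < 1810 * (n + 40) + 1007 ∧ inv q < 1810 * (n + 40) + 1007 ∧ pos (inv q) = q ∧
      inv (pos q) = q ∧ lateArr n q ≤ pos q ∧
      ∀ q' < 1810 * (n + 40) + 1007, pos q < pos q' → lateArr n q ≤ lateArr n q' := by
  refine exists_service_order (D := 810 * (n + 40)) (lateArr n) (fun q hq => lateArr_le hq)
    (fun q hq => ?_)
  -- The Y alone arrive one per round and keep the link busy.
  rw [lateArr, if_pos hq]

/-- The position in the order of service of the packet number `q` of those that accumulate during
the phase number `n`. -/
noncomputable def pos (n : ℕ) : ℕ → ℕ := (exists_late_order n).choose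

/-- The inverse of `pos`. -/
noncomputable def inv (n : ℕ) : ℕ → ℕ := (exists_late_order n).choose_spec.choose

theorem pos_spec (n : ℕ) : ∀ q < 1810 * (n + 40) + 1007,
    pos n q < 1810 * (n + 40) + 1007 ∧ inv n q < 1810 * (n + 40) + 1007 ∧ pos n (inv n q) = q ∧
      inv n (pos n q) = q ∧ lateArr n q ≤ pos n q ∧
      ∀ q' < 1810 * (n + 40) + 1007, pos n q < pos n q' → lateArr n q ≤ lateArr n q' :=
  (exists_late_order n).choose_spec.choose_spec

/-- The packets: an initial burst `I`, and four families for each phase. -/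
inductive Packet
  | I (j : ℕ) (h : j < 40000)
  | X (n j : ℕ) (h : j < 900 * (n + 40))
  | Y (n j : ℕ) (h : j < 810 * (n + 40))
  | Z (n j : ℕ) (h : j < 450 * (n + 40))
  | W (n j : ℕ) (h : j < 700 * (n + 40) + 1007)

/-- The packets that accumulate at their last link during the phase number `n`. -/
def late (n q : ℕ) (hq : q < 1810 * (n + 40) + 1007) : Packet :=
  if h1 : q < 810 * (n + 40) then .Y n q h1
  else if h2 : q < 1110 * (n + 40) then .X n (600 * (n + 40) + (q - 810 * (n + 40))) (by omega)
  else .W n (q - 1110 * (n + 40)) (by omega)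

/-- The round in which a packet is injected. -/
def birth : Packet → ℕ
  | .I _ _ => T 0
  | .X n j _ => T n + j + j / 9
  | .Y n j _ => T n + 1000 * (n + 40) + j + j / 9
  | .Z n j _ => T n + 1000 * (n + 40) + 2 * j + 2
  | .W n j _ => T n + 1900 * (n + 40) + j + j / 9

/-- The route of a packet. -/
def route : Packet → List (Bool × LinkKind)
  | .I _ _ => [(false, e), (false, a), (false, c), (true, e)]
  | .X n _ _ => [(half n, e), (half n, f), (half n, g), (!half n, e)]
  | .Y n _ _ => [(half n, e), (half n, a), (half n, c), (!half n, e)]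
  -- The link `h` lets Z reach `f` having crossed one link, as X has. Leaving by `y` spares the
  -- budget of the next entrance, which Y uses at the same time.
  | .Z n _ _ => [(half n, h), (half n, f), (half n, g), (half n, y)]
  -- Three private links make W arrive at the entrance having crossed as many links as X and Y.
  | .W n _ _ => [(half n, w), (half n, u), (half n, x), (!half n, e)]

/-- The round in which a packet crosses a link of its route. -/
noncomputable def cross : Packet → ℕ → ℕ
  | .I j _, k => T 0 + j + k
  | .X n j _, 0 => T n + 1000 * (n + 40) + j
  | .X n j _, 1 => T n + 1000 * (n + 40) + 1 + j + j / 2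
  | .X n j _, 2 => T n + 1000 * (n + 40) + 2 + j + j / 2
  | .X n j _, _ =>
    -- The first 600(n + 40) find the last link free; the others join the accumulating queue.
    if j < 600 * (n + 40) then T n + 1000 * (n + 40) + 3 + j + j / 2
    else T n + 1900 * (n + 40) + 3 + pos n (810 * (n + 40) + (j - 600 * (n + 40)))
  | .Y n j _, 0 => T n + 1900 * (n + 40) + j
  | .Y n j _, 1 => T n + 1900 * (n + 40) + j + 1
  | .Y n j _, 2 => T n + 1900 * (n + 40) + j + 2
  | .Y n j _, _ => T n + 1900 * (n + 40) + 3 + pos n j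
  | .Z n j _, 0 => T n + 1000 * (n + 40) + 2 * j + 2
  | .Z n j _, k => T n + 1000 * (n + 40) + 3 * j + 2 + k
  | .W n j _, 0 => T n + 1900 * (n + 40) + j + j / 9
  | .W n j _, 1 => T n + 1900 * (n + 40) + j + j / 9 + 1
  | .W n j _, 2 => T n + 1900 * (n + 40) + j + j / 9 + 2
  | .W n j _, _ => T n + 1900 * (n + 40) + 3 + pos n (1110 * (n + 40) + j)

/-- The timetable of the execution in which the number of packets grows. -/
noncomputable def table : Timetable net Packet where
  birth := birth
  route := route
  cross := cross

/-! ### Consistency of the schedule -/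

/-- `Visit p k i l s t`: the link number `k` of the route of `p` is the link `(i, l)`; the packet
arrives there in round `s` and crosses the link in round `t`. -/
inductive Visit : Packet → ℕ → Bool → LinkKind → ℕ → ℕ → Prop
  | eI (j : ℕ) (hj) : Visit (.I j hj) 0 (half 0) e (T 0) (T 0 + j)
  | eX (n j : ℕ) (hj) : Visit (.X n j hj) 0 (half n) e
      (T n + j + j / 9) (T n + 1000 * (n + 40) + j)
  | eY (n j : ℕ) (hj) : Visit (.Y n j hj) 0 (half n) e
      (T n + 1000 * (n + 40) + j + j / 9) (T n + 1900 * (n + 40) + j)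
  | lastI (j : ℕ) (hj) : Visit (.I j hj) 3 (!half 0) e (T 0 + j + 3) (T 0 + j + 3)
  | lastX (n j : ℕ) (hj) (h : j < 600 * (n + 40)) : Visit (.X n j hj) 3 (!half n) e
      (T n + 1000 * (n + 40) + 3 + j + j / 2) (T n + 1000 * (n + 40) + 3 + j + j / 2)
  | late (n q : ℕ) (hq) (h1 : lateArr n q ≤ 810 * (n + 40)) (h2 : lateArr n q ≤ pos n q)
      (h3 : pos n q < 1810 * (n + 40) + 1007) : Visit (late n q hq) 3 (!half n) e
      (T n + 1900 * (n + 40) + 3 + lateArr n q) (T n + 1900 * (n + 40) + 3 + pos n q)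
  | fX (n j : ℕ) (hj) : Visit (.X n j hj) 1 (half n) f
      (T n + 1000 * (n + 40) + j + 1) (T n + 1000 * (n + 40) + 1 + j + j / 2)
  | fZ (n j : ℕ) (hj) : Visit (.Z n j hj) 1 (half n) f
      (T n + 1000 * (n + 40) + 2 * j + 3) (T n + 1000 * (n + 40) + 3 * j + 3)
  | gX (n j : ℕ) (hj) : Visit (.X n j hj) 2 (half n) g
      (T n + 1000 * (n + 40) + 2 + j + j / 2) (T n + 1000 * (n + 40) + 2 + j + j / 2)
  | gZ (n j : ℕ) (hj) : Visit (.Z n j hj) 2 (half n) g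
      (T n + 1000 * (n + 40) + 3 * j + 4) (T n + 1000 * (n + 40) + 3 * j + 4)
  | aI (j : ℕ) (hj) : Visit (.I j hj) 1 (half 0) a (T 0 + j + 1) (T 0 + j + 1)
  | aY (n j : ℕ) (hj) : Visit (.Y n j hj) 1 (half n) a
      (T n + 1900 * (n + 40) + j + 1) (T n + 1900 * (n + 40) + j + 1)
  | cI (j : ℕ) (hj) : Visit (.I j hj) 2 (half 0) c (T 0 + j + 2) (T 0 + j + 2)
  | cY (n j : ℕ) (hj) : Visit (.Y n j hj) 2 (half n) c
      (T n + 1900 * (n + 40) + j + 2) (T n + 1900 * (n + 40) + j + 2)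
  | hZ (n j : ℕ) (hj) : Visit (.Z n j hj) 0 (half n) h
      (T n + 1000 * (n + 40) + 2 * j + 2) (T n + 1000 * (n + 40) + 2 * j + 2)
  | yZ (n j : ℕ) (hj) : Visit (.Z n j hj) 3 (half n) y
      (T n + 1000 * (n + 40) + 3 * j + 5) (T n + 1000 * (n + 40) + 3 * j + 5)
  | wW (n j : ℕ) (hj) : Visit (.W n j hj) 0 (half n) w
      (T n + 1900 * (n + 40) + j + j / 9) (T n + 1900 * (n + 40) + j + j / 9)
  | uW (n j : ℕ) (hj) : Visit (.W n j hj) 1 (half n) u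
      (T n + 1900 * (n + 40) + j + j / 9 + 1) (T n + 1900 * (n + 40) + j + j / 9 + 1)
  | xW (n j : ℕ) (hj) : Visit (.W n j hj) 2 (half n) x
      (T n + 1900 * (n + 40) + j + j / 9 + 2) (T n + 1900 * (n + 40) + j + j / 9 + 2)

theorem visit_late (n q : ℕ) (hq) : Visit (late n q hq) 3 (!half n) e
    (T n + 1900 * (n + 40) + 3 + lateArr n q) (T n + 1900 * (n + 40) + 3 + pos n q) :=
  have h := pos_spec n q hq
  .late n q hq (lateArr_le hq) h.2.2.2.2.1 h.1

theorem late_of_Y (n j : ℕ) (hj : j < 810 * (n + 40)) :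
    late n j (by omega) = .Y n j hj ∧ lateArr n j = j := by
  rw [late, dif_pos hj, lateArr, if_pos hj]
  exact ⟨rfl, rfl⟩

theorem late_of_X (n j : ℕ) (hj : j < 900 * (n + 40)) (h : 600 * (n + 40) ≤ j) :
    late n (810 * (n + 40) + (j - 600 * (n + 40))) (by omega) = .X n j hj ∧
      lateArr n (810 * (n + 40) + (j - 600 * (n + 40))) =
        (j - 600 * (n + 40)) + (j - 600 * (n + 40)) / 2 := by
  have h1 : ¬ 810 * (n + 40) + (j - 600 * (n + 40)) < 810 * (n + 40) := by omega
  have h2 : 810 * (n + 40) + (j - 600 * (n + 40)) < 1110 * (n + 40) := by omega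
  rw [late, dif_neg h1, dif_pos h2, lateArr, if_neg h1, if_pos h2]
  simp only [Packet.X.injEq, true_and, add_tsub_cancel_left, and_true]
  omega

theorem late_of_W (n j : ℕ) (hj : j < 700 * (n + 40) + 1007) :
    late n (1110 * (n + 40) + j) (by omega) = .W n j hj ∧
      lateArr n (1110 * (n + 40) + j) = j + j / 9 := by
  have h1 : ¬ 1110 * (n + 40) + j < 810 * (n + 40) := by omega
  have h2 : ¬ 1110 * (n + 40) + j < 1110 * (n + 40) := by omega
  rw [late, dif_neg h1, dif_neg h2, lateArr, if_neg h1, if_neg h2]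
  simp only [add_tsub_cancel_left, and_self]

/-- Turns the schedule into a finite list of cases with linear formulas; the packets that
accumulate, from three families, become the single case `Visit.late`. -/
theorem visit {p : Packet} {k : ℕ} {i : Bool} {l : LinkKind} (hk : (route p)[k]? = some (i, l)) :
    Visit p k i l (table.arr p k) (table.cross p k) := by
  have hk4 : k < 4 := by
    have := (List.getElem?_eq_some_iff.1 hk).1
    cases p <;> exact this
  rcases p with ⟨j, hj⟩ | ⟨n, j, hj⟩ | ⟨n, j, hj⟩ | ⟨n, j, hj⟩ | ⟨n, j, hj⟩ <;> interval_cases k <;>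
    (obtain ⟨rfl, rfl⟩ := Prod.mk.inj (Option.some.inj hk).symm)
  · exact .eI j hj
  · exact .aI j hj
  · exact .cI j hj
  · exact .lastI j hj
  · exact .eX n j hj
  · exact .fX n j hj
  · convert Visit.gX n j hj using 1
    · simp only [Timetable.arr, table, cross]
      omega
    · rfl
  · by_cases h : j < 600 * (n + 40)
    · convert Visit.lastX n j hj h using 1
      · simp only [Timetable.arr, table, cross]
        omega
      · simp only [table, cross, if_pos h]
    · have h0 := visit_late n (810 * (n + 40) + (j - 600 * (n + 40))) (by omega)
      obtain ⟨h1, h2⟩ := late_of_X n j hj (by omega)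
      rw [h1, h2] at h0
      convert h0 using 1
      · simp only [Timetable.arr, table, cross]
        omega
      · simp only [table, cross, if_neg h]
  · exact .eY n j hj
  · exact .aY n j hj
  · exact .cY n j hj
  · have h0 := visit_late n j (by omega)
    obtain ⟨h1, h2⟩ := late_of_Y n j hj
    rw [h1, h2] at h0
    convert h0 using 1
    · simp only [Timetable.arr, table, cross]
      omega
    · rfl
  · exact .hZ n j hj
  · exact .fZ n j hj
  · exact .gZ n j hj
  · exact .yZ n j hj
  · exact .wW n j hj
  · exact .uW n j hj
  · exact .xW n j hj
  · have h0 := visit_late n (1110 * (n + 40) + j) (by omega)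
    obtain ⟨h1, h2⟩ := late_of_W n j hj
    rw [h1, h2] at h0
    convert h0 using 1
    · simp only [Timetable.arr, table, cross]
      omega
    · rfl

/-- The number of the family of a packet. -/
def kind : Packet → ℕ
  | .I _ _ => 0
  | .X _ _ _ => 1
  | .Y _ _ _ => 2
  | .Z _ _ _ => 3
  | .W _ _ _ => 4

/-- The number of the phase in which a packet is injected. -/
def phase : Packet → ℕ
  | .I _ _ => 0
  | .X n _ _ => n
  | .Y n _ _ => n
  | .Z n _ _ => n
  | .W n _ _ => n

/-- The number of a packet in its family. -/
def index : Packet → ℕ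
  | .I j _ => j
  | .X _ j _ => j
  | .Y _ j _ => j
  | .Z _ j _ => j
  | .W _ j _ => j

theorem eq_of_kind_phase_index {p p' : Packet}
    (h : kind p = kind p' ∧ phase p = phase p' ∧ index p = index p') : p = p' := by
  obtain ⟨h1, h2, h3⟩ := h
  cases p <;> cases p' <;> first
    | (simp only [kind] at h1; omega)
    | (simp only [phase] at h2; simp only [index] at h3; subst h2; subst h3; rfl)
    | (simp only [index] at h3; subst h3; rfl)

theorem phase_late (n q : ℕ) (hq) : phase (late n q hq) = n := by
  unfold late
  split_ifs <;> rfl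

-- Visits to a link from different phases are separated by the gaps in `T_cases` and the parity of
-- the halves; within a phase the formulas decide. Only two accumulating packets need the abstract
-- order `pos`.
set_option maxHeartbeats 2000000 in
theorem order {p p' : Packet} {k k' : ℕ} {i i' : Bool} {l : LinkKind} {s s' t t' : ℕ}
    (hv : Visit p k i l s t) (hv' : Visit p' k' i' l s' t') (hi : i = i') (h1 : s' ≤ t)
    (h2 : t ≤ t') : (p = p' ∧ k = k') ∨ (t < t' ∧ s ≤ s' ∧ (k' = k ∨ k' = 0)) := by
  suffices h : ((kind p = kind p' ∧ phase p = phase p' ∧ index p = index p') ∧ k = k') ∨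
      (t < t' ∧ s ≤ s' ∧ (k' = k ∨ k' = 0)) from h.imp_left (And.imp_left eq_of_kind_phase_index)
  have hT := T_cases (phase p) (phase p')
  cases hv <;> cases hv'
  case late.late n q hq _ _ _ n' q' hq' _ _ _ =>
    rw [phase_late, phase_late] at hT
    rw [Bool.not_inj_iff, half_eq_half] at hi
    obtain rfl : n = n' := by omega
    have hs := pos_spec n q hq
    have hs' := pos_spec n q' hq'
    rcases (show pos n q ≤ pos n q' by omega).lt_or_eq with h | h
    · exact Or.inr ⟨by omega, by have := hs.2.2.2.2.2 q' hq' h; omega, Or.inl rfl⟩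
    · obtain rfl : q = q' := by rw [← hs.2.2.2.1, h, hs'.2.2.2.1]
      exact Or.inl ⟨⟨rfl, rfl, rfl⟩, rfl⟩
  all_goals
    (try rw [phase_late] at hT)
    simp only [phase, kind, index, half_eq_half, half_eq_not_half, not_half_eq_half,
      Bool.not_inj_iff, true_and, and_true, or_true, true_or] at hi hT ⊢
    omega

theorem route_late (n q : ℕ) (hq) : (route (late n q hq))[3]? = some (!half n, e) := by
  unfold late
  split_ifs <;> rfl

theorem birth_late (n q : ℕ) (hq) : birth (late n q hq) ≤ T (n + 1) := by
  unfold late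
  rw [T_succ]
  split_ifs <;> simp only [birth] <;> omega

theorem cross_late (n q : ℕ) (hq) :
    cross (late n q hq) 3 = T n + 1900 * (n + 40) + 3 + pos n q := by
  unfold late
  split_ifs with h1 h2
  · rfl
  · simp only [cross]
    rw [if_neg (by omega), show 810 * (n + 40) + (600 * (n + 40) + (q - 810 * (n + 40)) -
      600 * (n + 40)) = q by omega]
  · simp only [cross]
    rw [show 1110 * (n + 40) + (q - 1110 * (n + 40)) = q by omega]

/-- The packets that accumulate during a phase cross their last link one per round. -/
theorem exists_late (n x : ℕ) (hx : x < 1810 * (n + 40) + 1007) :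
    ∃ q hq, cross (late n q hq) 3 = T n + 1900 * (n + 40) + 3 + x := by
  obtain ⟨-, h1, h2, -⟩ := pos_spec n x hx
  exact ⟨inv n x, h1, by rw [cross_late, h2]⟩

/-- In the first stage of a phase the packets accumulated before cross their last link. -/
theorem exists_cross (n x : ℕ) (hx : x < 1000 * (n + 40)) :
    ∃ p k, (route p)[k]? = some (half n, e) ∧ cross p k = T n + x := by
  cases n with
  | zero => exact ⟨.I x hx, 0, rfl, rfl⟩
  | succ n =>
    -- Service of the accumulated packets starts at T n + 1900(n + 40) + 3, so 810(n + 40) + 7 of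
    -- them are gone when the next phase begins.
    obtain ⟨q, hq, h⟩ := exists_late n (810 * (n + 40) + 7 + x) (by omega)
    refine ⟨late n q hq, 3, ?_, ?_⟩
    · rw [route_late, (not_half_eq_half (m := n + 1)).2 (by omega)]
    · rw [h, T_succ]
      omega

/-- Queues form only at `e` and `f`; elsewhere arrival and crossing coincide. -/
theorem busy {p : Packet} {k : ℕ} {i : Bool} {l : LinkKind} {s t u : ℕ}
    (hv : Visit p k i l s t) (hr : (route p)[k]? = some (i, l)) (hc : cross p k = t) (h1 : s ≤ u)
    (h2 : u ≤ t) : ∃ p' k', (route p')[k']? = some (i, l) ∧ cross p' k' = u := by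
  rcases h2.eq_or_lt with rfl | h3
  · exact ⟨p, k, hr, hc⟩
  cases hv
  case eI j hj => exact ⟨.I (u - T 0) (by omega), 0, rfl, by simp only [cross]; omega⟩
  case eX n j hj =>
    by_cases h : u < T n + 1000 * (n + 40)
    · obtain ⟨p', k', h4, h5⟩ := exists_cross n (u - T n) (by omega)
      exact ⟨p', k', h4, by omega⟩
    · exact ⟨.X n (u - T n - 1000 * (n + 40)) (by omega), 0, rfl, by simp only [cross]; omega⟩
  case eY n j hj =>
    by_cases h : u < T n + 1900 * (n + 40)
    · exact ⟨.X n (u - T n - 1000 * (n + 40)) (by omega), 0, rfl, by simp only [cross]; omega⟩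
    · exact ⟨.Y n (u - T n - 1900 * (n + 40)) (by omega), 0, rfl, by simp only [cross]; omega⟩
  case late n q hq _ _ _ =>
    obtain ⟨q', hq', h⟩ := exists_late n (u - T n - 1900 * (n + 40) - 3) (by omega)
    exact ⟨late n q' hq', 3, route_late n q' hq', by omega⟩
  case fX n j hj =>
    have hu : u = T n + 1000 * (n + 40) + 1 + (u - T n - 1000 * (n + 40) - 1) := by omega
    generalize u - T n - 1000 * (n + 40) - 1 = x at hu
    -- The link `f` serves with period three: X, X, Z.
    by_cases h : x % 3 = 2
    · exact ⟨.Z n (x / 3) (by omega), 1, rfl, by simp only [cross]; omega⟩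
    · exact ⟨.X n (2 * (x / 3) + x % 3) (by omega), 1, rfl, by simp only [cross]; omega⟩
  case fZ n j hj =>
    have hu : u = T n + 1000 * (n + 40) + 1 + (u - T n - 1000 * (n + 40) - 1) := by omega
    generalize u - T n - 1000 * (n + 40) - 1 = x at hu
    by_cases h : x % 3 = 2
    · exact ⟨.Z n (x / 3) (by omega), 1, rfl, by simp only [cross]; omega⟩
    · exact ⟨.X n (2 * (x / 3) + x % 3) (by omega), 1, rfl, by simp only [cross]; omega⟩
  all_goals omega

/-! ### The injections respect the budget -/

theorem T_zero_le_birth (p : Packet) : T 0 ≤ birth p := by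
  cases p <;> simp only [birth]
  · exact le_rfl
  all_goals
    rename_i n _ _
    have := T_zero_le n
    omega

/-- After the first round of the initial burst, at most one packet per link is injected in each
round. -/
theorem eq_of_birth_eq {p p' : Packet} {q : Bool × LinkKind} (h0 : T 0 < birth p)
    (hb : birth p = birth p') (hq : q ∈ route p) (hq' : q ∈ route p') : p = p' := by
  apply eq_of_kind_phase_index
  have hT := T_cases (phase p) (phase p')
  rcases p with ⟨j, hj⟩ | ⟨n, j, hj⟩ | ⟨n, j, hj⟩ | ⟨n, j, hj⟩ | ⟨n, j, hj⟩ <;>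
  rcases p' with ⟨j', hj'⟩ | ⟨n', j', hj'⟩ | ⟨n', j', hj'⟩ | ⟨n', j', hj'⟩ | ⟨n', j', hj'⟩ <;>
  simp only [birth, phase, kind, index, true_and] at h0 hb hT ⊢ <;>
  -- After the burst only Z can share a birth round with another family, Y or W, and its links are
  -- of other kinds than theirs.
  first
    | omega
    | (simp only [route, List.mem_cons, List.not_mem_nil, or_false] at hq hq'
       rcases hq with rfl | rfl | rfl | rfl <;> simp at hq')

/-- Phases start at multiples of ten, j + j/9 skips the residue 9, and Z is injected in even rounds.
-/
theorem birth_mod {p : Packet} (h0 : T 0 < birth p) : birth p % 10 ≠ 9 := by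
  rcases p with ⟨j, hj⟩ | ⟨n, j, hj⟩ | ⟨n, j, hj⟩ | ⟨n, j, hj⟩ | ⟨n, j, hj⟩
  · exact absurd h0 (lt_irrefl _)
  all_goals
    have := T_mod n
    simp only [birth]
    omega

/-- The first X is born together with the burst, whence the allowance N + 1 in
`Timetable.isAdmissible`. -/
theorem setOf_birth_eq_T_zero_subset : {p | birth p = T 0} ⊆
    insert (.X 0 0 (by omega)) (Set.range fun j : Fin 40000 => Packet.I j j.2) := by
  intro p h
  replace h : birth p = T 0 := h
  have hT := T_cases 0 (phase p)
  rcases p with ⟨j, hj⟩ | ⟨n, j, hj⟩ | ⟨n, j, hj⟩ | ⟨n, j, hj⟩ | ⟨n, j, hj⟩ <;>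
    simp only [birth, phase] at h hT
  · exact Or.inr ⟨⟨j, hj⟩, rfl⟩
  · obtain rfl : n = 0 := by omega
    obtain rfl : j = 0 := by omega
    exact Or.inl rfl
  all_goals omega

theorem finite_birth (t : ℕ) : {p | birth p = t}.Finite := by
  rcases lt_trichotomy t (T 0) with h | rfl | h
  · convert Set.finite_empty
    refine Set.eq_empty_of_forall_notMem fun p hp => ?_
    have := T_zero_le_birth p
    have : birth p = t := hp
    omega
  · exact ((Set.finite_range _).insert _).subset setOf_birth_eq_T_zero_subset
  · have hfin : ∀ q : Bool × LinkKind, {p | birth p = t ∧ q ∈ route p}.Finite := fun q =>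
      Set.Subsingleton.finite fun p hp p' hp' =>
        eq_of_birth_eq (h.trans_eq hp.1.symm) (hp.1.trans hp'.1.symm) hp.2 hp'.2
    refine (Set.finite_iUnion hfin).subset fun p hp => ?_
    obtain ⟨q, hq⟩ : ∃ q, q ∈ route p := by cases p <;> exact ⟨_, List.mem_cons_self⟩
    exact Set.mem_iUnion.2 ⟨q, hp, hq⟩

theorem nodup_route (p : Packet) : (route p).Nodup := by
  cases p <;> simp [route]

theorem isChain_route (p : Packet) : (route p).IsChain fun q r => tgt q = src r := by
  cases p <;> simp [route, src, tgt]

theorem isRoute (p : Packet) : net.IsRoute (route p) :=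
  ⟨by cases p <;> exact List.cons_ne_nil _ _, nodup_route p, isChain_route p⟩

theorem isValid : table.IsValid 4 where
  finite_birth := finite_birth
  isRoute := isRoute
  length_route p := by cases p <;> rfl
  arr_le p k hk := by
    have hlen : k < (route p).length := by cases p <;> exact hk
    obtain ⟨⟨i, l⟩, hq⟩ : ∃ q, (route p)[k]? = some q := ⟨_, List.getElem?_eq_getElem hlen⟩
    have hv := visit hq
    generalize table.arr p k = s at hv
    generalize table.cross p k = t at hv
    cases hv <;> omega
  order p k p' k' q hq hq' h1 h2 := order (visit hq) (visit hq') rfl h1 h2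
  busy p k q t hq h1 h2 := busy (visit hq) hq rfl h1 h2

/-! ### Unbounded growth -/

theorem isAdmissible (δ : ℕ) : table.toRun.IsAdmissible (9 / 10) (40000 + 10) δ := by
  have h0 : T 0 = 20 * 40000 := T_zero
  refine Timetable.isAdmissible table unitTime_net (by norm_num) δ ?_ ?_ ?_ ?_
  · intro q t ht
    rw [← h0] at ht
    unfold Run.injected
    convert Set.ncard_empty Packet
    refine Set.eq_empty_of_forall_notMem fun p hp => ?_
    have := T_zero_le_birth p
    have : birth p = t := hp.1
    omega
  · intro q
    rw [← h0]
    have hfin : (Set.range fun j : Fin 40000 => Packet.I j j.2).Finite := Set.finite_range _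
    refine (Set.ncard_le_ncard (fun p hp => setOf_birth_eq_T_zero_subset hp.1) (hfin.insert _)).trans
      ((Set.ncard_insert_le _ _).trans (Nat.succ_le_succ ?_))
    rw [← Set.image_univ]
    refine (Set.ncard_image_le Set.finite_univ).trans ?_
    rw [Set.ncard_univ, Nat.card_eq_fintype_card, Fintype.card_fin]
  · intro q t ht
    rw [← h0] at ht
    refine (Set.ncard_le_one ((finite_birth t).subset fun p hp => hp.1)).2 ?_
    exact fun p hp p' hp' =>
      eq_of_birth_eq (ht.trans_eq hp.1.symm) (hp.1.trans hp'.1.symm) hp.2 hp'.2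
  · intro q t ht h9
    rw [← h0] at ht
    unfold Run.injected
    convert Set.ncard_empty Packet
    refine Set.eq_empty_of_forall_notMem fun p hp => ?_
    have : birth p = t := hp.1
    have := birth_mod (p := p) (by omega)
    omega

/-- Of the 1810(n + 40) + 1007 accumulated packets, 810(n + 40) + 7 have left; each phase thus
starts with 1000 packets more than the one before. -/
theorem le_queued (n : ℕ) : 1000 * (n + 41) ≤ table.toRun.queued (T (n + 1)) := by
  refine isValid.le_queued unitTime_net (k := 3) (q := (!half n, e)) fun x hx => ?_
  obtain ⟨q, hq, h⟩ := exists_late n (810 * (n + 40) + 7 + x) (by omega)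
  refine ⟨late n q hq, birth_late n q hq, route_late n q hq, h.trans ?_⟩
  rw [T_succ]
  omega

theorem unstable {S : Policy} (hS : S ∈ ({FIFO, NTG, FFS, SPLNFS} : Set Policy)) (δ : ℕ) :
    Unstable S net (9 / 10) (40000 + 10) δ := by
  intro h
  obtain ⟨C, hC⟩ := h Packet table.toRun (isValid.isExecution unitTime_net hS) (isAdmissible δ)
  have h1 := hC (T (C + 1))
  have h2 := le_queued C
  omega

end Pump
end AdversarialRouting

open AdversarialRouting in
theorem mainTheorem5 :
    (∀ S ∈ ({FIFO, NTG, FFS} : Set Policy),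
      ∃ G : Network, G.UnitTime ∧ ∃ (r : ℝ) (b : ℕ), 0 < r ∧ r < 1 ∧ 1 ≤ b ∧
        ∀ δ : ℕ, 1 ≤ δ → Unstable S G r b δ) ∧
    (∃ G : Network, ∃ (r : ℝ) (b : ℕ), 0 < r ∧ r < 1 ∧ 1 ≤ b ∧
        ∀ δ : ℕ, 1 ≤ δ → Unstable SPLNFS G r b δ) := by
  refine ⟨fun S hS => ⟨Pump.net, Pump.unitTime_net, 9 / 10, 40000 + 10, by norm_num, by norm_num,
    by norm_num, fun δ _ => Pump.unstable ?_ δ⟩, Pump.net, 9 / 10, 40000 + 10, by norm_num,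
    by norm_num, by norm_num, fun δ _ => Pump.unstable ?_ δ⟩
  · rcases hS with h | h | h
    · exact Or.inl h
    · exact Or.inr (Or.inl h)
    · exact Or.inr (Or.inr (Or.inl h))
  · exact Or.inr (Or.inr (Or.inr rfl))
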